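/- For $\Theta\in\mathbb{R}^{d_1\times d_2\times d_3}$ ($d_1,d_2,d_3\ge 1$) let $\Theta_{\cdot\cdot k}\in\mathbb{R}^{d_1\times d_2}$, $k\in[d_3]$, be its $(1,2)$-slices, let $R(\Theta)=\|\Theta\|_{(1,2),*}=\sum_{k\in[d_3]}\|\Theta_{\cdot\cdot k}\|_*$ (sum of the nuclear norms of the slices), and let $R^*(\Theta)=\sup\{\langle\Theta,\mathcal B\rangle : R(\mathcal B)\le 1\}$ be its dual norm. Then $R^*(\Theta)=\max_{k\in[d_3]}\|\Theta_{\cdot\cdot k}\|$, the maximal slice operator norm. Moreover, there is an absolute constant $c>0$ such that the following holds. Let $d_1,d_2,d_3,T_1\ge 1$, $d=\max\{d_1,d_2,d_3\}$, let $\sigma\ge 0$, $0<c_R\le 1$, $\alpha=\frac{c_R+3}{2c_R}$ and $\delta\in(0,1)$. Let $\mathcal X_1,\dots,\mathcal X_{T_1}$ be the (random) contexts selected in the $T_1$ exploration rounds, tensors in $\mathbb{R}^{d_1\times d_2\times d_3}$ with $\|\mathcal X_t\|_F\le 1$ almost surely, and let $\epsilon_1,\dots,\epsilon_{T_1}$ be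 the noise variables of the rewards: each $\epsilon_t$ is $\sigma$-sub-Gaussian, i.e. $\mathbb{E}\,e^{s\epsilon_t}\le e^{\sigma^2s^2/2}$ for all $s\in\mathbb{R}$, and $\mathbb{E}(\epsilon_t\mid\mathcal F_t)=0$ for a filtration $(\mathcal F_t)$ such that $\mathcal X_t$ is $\mathcal F_t$-measurable and $\epsilon_t$ is $\mathcal F_{t+1}$-measurable (this includes the case in which the pairs $(\mathcal X_t,\epsilon_t)$ are independent over $t$ with $\mathbb{E}(\epsilon_t\mid\mathcal X_t)=0$). Put $$\lambda_{T_1}=\frac{c\,\alpha\,\sigma}{\sqrt{T_1}}\sqrt{\log\frac{4T_1d}{\delta}\,\log\frac{4d}{\delta}} .$$ Then, with probability at least $1-\delta$, $$\lambda_{T_1}\ \ge\ \alpha\,R^*\Big(\frac{1}{T_1}\sum_{t\in[T_1]}\epsilon_t\,\mathcal X_t\Big).$$ -/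

import Mathlib

open MeasureTheory ProbabilityTheory
open scoped NNReal

noncomputable section

/-- Third-order real tensors of dimensions `d₁ × d₂ × d₃`. -/
abbrev Tensor3 (d₁ d₂ d₃ : ℕ) : Type := Fin d₁ → Fin d₂ → Fin d₃ → ℝ

namespace Tensor3

variable {d₁ d₂ d₃ : ℕ}

/-- The tensor inner product. -/
def inner (A B : Tensor3 d₁ d₂ d₃) : ℝ := ∑ i, ∑ j, ∑ k, A i j k * B i j k

/-- The Frobenius norm. -/
def frobNorm (A : Tensor3 d₁ d₂ d₃) : ℝ := Real.sqrt (inner A A)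

/-- The `k`-th (1,2)-slice `A_{··k}`, a `d₁ × d₂` matrix. -/
def slice (A : Tensor3 d₁ d₂ d₃) (k : Fin d₃) : Matrix (Fin d₁) (Fin d₂) ℝ :=
  Matrix.of fun i j => A i j k

end Tensor3

/-- The nuclear norm of a matrix: the sum of its singular values. -/
def nuclearNorm {m n : ℕ} (M : Matrix (Fin m) (Fin n) ℝ) : ℝ :=
  ∑ i ∈ Finset.range n, (Matrix.toEuclideanLin M).singularValues i

/-- The operator norm of a matrix with respect to the Euclidean norms (largest singular value). -/
def matrixOpNorm {m n : ℕ} (M : Matrix (Fin m) (Fin n) ℝ) : ℝ :=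
  ‖LinearMap.toContinuousLinearMap (Matrix.toEuclideanLin M)‖

namespace Tensor3

variable {d₁ d₂ d₃ : ℕ}

/-- The regularizer `R(Θ) = ‖Θ‖_{(1,2),*} = ∑ₖ ‖Θ_{··k}‖_*`. -/
def sliceNuclearNorm (A : Tensor3 d₁ d₂ d₃) : ℝ := ∑ k, nuclearNorm (slice A k)

/-- The maximal slice operator norm `maxₖ ‖A_{··k}‖`. -/
def maxSliceOpNorm (A : Tensor3 d₁ d₂ d₃) : ℝ := ⨆ k : Fin d₃, matrixOpNorm (slice A k)

/-- The dual norm `N^*(A) = sup {⟨A, B⟩ : N(B) ≤ 1}` of a norm `N` on tensors. -/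
def dualNorm (N : Tensor3 d₁ d₂ d₃ → ℝ) (A : Tensor3 d₁ d₂ d₃) : ℝ :=
  sSup {x : ℝ | ∃ B : Tensor3 d₁ d₂ d₃, N B ≤ 1 ∧ x = inner A B}

end Tensor3

/-- The constant `α = (c_R + 3) / (2 c_R)`. -/
def alphaConst (cR : ℝ) : ℝ := (cR + 3) / (2 * cR)

/-- The regularization parameter
`λ_{T₁} = (c α R / √T₁) √(log (4 T₁ d / δ) log (4 d / δ))`. -/
def regParam (c α R : ℝ) (T₁ d : ℕ) (δ : ℝ) : ℝ :=
  c * α * R / Real.sqrt T₁ *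
    Real.sqrt (Real.log (4 * T₁ * d / δ) * Real.log (4 * d / δ))

/-- The data of an exploration phase of `T₁` rounds, rounds being numbered `0, …, T₁ - 1`.
`ℱ t` is the information available when the reward of round `t` is about to be drawn: it contains
the selected context `X t` and all earlier contexts and noises. The contexts have Frobenius norm at
most one, and the noise `ε t` is `R`-sub-Gaussian (`E exp (s ε_t) ≤ exp (R² s² / 2)` for all `s`)
with conditional mean zero. Independence of the pairs `(X t, ε t)` over the rounds together with
`E (ε_t | X_t) = 0` is a special case, with `ℱ t = σ(X_0, …, X_t, ε_0, …, ε_{t-1})`. -/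
structure IsExploration {Ω : Type*} {mΩ : MeasurableSpace Ω} (P : Measure Ω)
    (ℱ : Filtration ℕ mΩ) {d₁ d₂ d₃ : ℕ} (R : ℝ≥0) (T₁ : ℕ)
    (X : ℕ → Ω → Tensor3 d₁ d₂ d₃) (ε : ℕ → Ω → ℝ) : Prop where
  measurable_context : ∀ t < T₁, Measurable[ℱ t] (X t)
  measurable_noise : ∀ t < T₁, Measurable[ℱ (t + 1)] (ε t)
  context_bound : ∀ t < T₁, ∀ᵐ ω ∂P, Tensor3.frobNorm (X t ω) ≤ 1
  noise_condExp : ∀ t < T₁, P[ε t | ℱ t] =ᵐ[P] 0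
  noise_subGaussian : ∀ t < T₁, HasSubgaussianMGF (ε t) (R ^ 2) P

/-- The tensor `(1 / T₁) ∑_t ε_t X_t`. -/
def noiseAverage {Ω : Type*} {d₁ d₂ d₃ : ℕ} (T₁ : ℕ)
    (X : ℕ → Ω → Tensor3 d₁ d₂ d₃) (ε : ℕ → Ω → ℝ) (ω : Ω) : Tensor3 d₁ d₂ d₃ :=
  (1 / (T₁ : ℝ)) • ∑ t ∈ Finset.range T₁, ε t ω • X t ω

end

/-! The dual norm is computed slice by slice. Trace duality `tr (AᵀB) ≤ ‖A‖ ‖B‖_*`, obtained by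
evaluating the trace in an orthonormal eigenbasis of `BᵀB`, bounds it by the maximal slice operator
norm, and rank-one tensors supported in one slice show that this bound is sharp
(`Tensor3.dualNorm_sliceNuclearNorm`).

For the probabilistic bound, the operator norm of a slice is at most the Frobenius norm of the
tensor, and the contexts have Frobenius norm at most one. It therefore suffices to control
`∑ ε_t X_t` in the Euclidean space of tensors, where a dimension-free Azuma inequality
(`measureReal_le_norm_sum_smul_le`) replaces matrix concentration. That inequality follows from an
exponential moment bound for `cosh ‖S‖`: since `x ↦ cosh √x` is convex and increasing,
`cosh ‖a + y‖` is at most `cosh b cosh ‖a‖` plus a term linear in `y` whenever `‖y‖ ≤ b` (`cosh_norm_add_le`).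

The noise is sub-Gaussian only unconditionally, so it is truncated at the level `4 R √L` with
`L = log (4 T d / δ)` and recentred by its conditional mean. The truncated and recentred noise is a
bounded martingale difference. The discarded part and the conditional means of the truncated part
have total `L¹` norm of order `R T exp (-2 L)`, so Markov's inequality disposes of them
(`measureReal_le_norm_sum_noise_smul_le`). The factor `√L` in the regularization parameter comes
from the truncation level, the factor `√(log (4 d / δ))` from the Azuma tail. -/

/-! ### Singular values and trace duality -/

theorem LinearMap.norm_apply_eigenvectorBasis_adjoint_comp_self {E F : Type*}
    [NormedAddCommGroup E] [InnerProductSpace ℝ E] [FiniteDimensional ℝ E]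
    [NormedAddCommGroup F] [InnerProductSpace ℝ F] [FiniteDimensional ℝ F]
    (T : E →ₗ[ℝ] F) {n : ℕ} (hn : Module.finrank ℝ E = n) (i : Fin n) :
    ‖T (T.isSymmetric_adjoint_comp_self.eigenvectorBasis hn i)‖ = T.singularValues i := by
  set v := T.isSymmetric_adjoint_comp_self.eigenvectorBasis hn i with hv
  have h1 : ‖T v‖ ^ 2 = T.singularValues i ^ 2 := by
    have h2 := T.isSymmetric_adjoint_comp_self.apply_eigenvectorBasis hn i
    rw [T.sq_singularValues_fin hn, ← real_inner_self_eq_norm_sq, ← LinearMap.adjoint_inner_right,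
      ← LinearMap.comp_apply, h2, ← hv, real_inner_smul_right, real_inner_self_eq_norm_sq,
      (T.isSymmetric_adjoint_comp_self.eigenvectorBasis hn).norm_eq_one]
    simp
  exact (pow_left_inj₀ (norm_nonneg _) (T.singularValues_nonneg i) two_ne_zero).1 h1

theorem singularValues_le_matrixOpNorm {m n : ℕ} (M : Matrix (Fin m) (Fin n) ℝ) (i : Fin n) :
    (Matrix.toEuclideanLin M).singularValues i ≤ matrixOpNorm M := by
  rw [← LinearMap.norm_apply_eigenvectorBasis_adjoint_comp_self _ finrank_euclideanSpace_fin i]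
  refine ((LinearMap.toContinuousLinearMap (Matrix.toEuclideanLin M)).le_opNorm _).trans_eq ?_
  rw [OrthonormalBasis.norm_eq_one, mul_one]
  rfl

theorem norm_toEuclideanLin_apply_le {m n : ℕ} (M : Matrix (Fin m) (Fin n) ℝ)
    (x : EuclideanSpace ℝ (Fin n)) : ‖Matrix.toEuclideanLin M x‖ ≤ matrixOpNorm M * ‖x‖ :=
  (LinearMap.toContinuousLinearMap (Matrix.toEuclideanLin M)).le_opNorm x

theorem matrixOpNorm_le_of_forall {m n : ℕ} {M : Matrix (Fin m) (Fin n) ℝ} {C : ℝ} (hC : 0 ≤ C)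
    (h : ∀ x, ‖Matrix.toEuclideanLin M x‖ ≤ C * ‖x‖) : matrixOpNorm M ≤ C :=
  ContinuousLinearMap.opNorm_le_bound _ hC h

theorem matrixOpNorm_nonneg {m n : ℕ} (M : Matrix (Fin m) (Fin n) ℝ) : 0 ≤ matrixOpNorm M :=
  norm_nonneg _

theorem nuclearNorm_nonneg {m n : ℕ} (M : Matrix (Fin m) (Fin n) ℝ) : 0 ≤ nuclearNorm M :=
  Finset.sum_nonneg fun i _ => LinearMap.singularValues_nonneg _ i

theorem nuclearNorm_zero {m n : ℕ} : nuclearNorm (0 : Matrix (Fin m) (Fin n) ℝ) = 0 := by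
  simp [nuclearNorm]

/-- Trace duality between the operator norm and the nuclear norm. The trace of `AᵀB` is computed
in an orthonormal basis `v` of eigenvectors of `BᵀB`, for which `‖B vᵢ‖` is the `i`-th singular
value of `B`. -/
theorem sum_mul_le_matrixOpNorm_mul_nuclearNorm {m n : ℕ} (A B : Matrix (Fin m) (Fin n) ℝ) :
    ∑ i, ∑ j, A i j * B i j ≤ matrixOpNorm A * nuclearNorm B := by
  set S := Matrix.toEuclideanLin A
  set T := Matrix.toEuclideanLin B with hT
  have htr : ∀ b : OrthonormalBasis (Fin n) ℝ (EuclideanSpace ℝ (Fin n)),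
      LinearMap.trace ℝ _ (LinearMap.adjoint S ∘ₗ T) = ∑ j, inner ℝ (S (b j)) (T (b j)) := by
    intro b
    rw [LinearMap.trace_eq_sum_inner _ b]
    simp [LinearMap.adjoint_inner_right]
  have h0 : ∑ i, ∑ j, A i j * B i j = LinearMap.trace ℝ _ (LinearMap.adjoint S ∘ₗ T) := by
    rw [htr (EuclideanSpace.basisFun (Fin n) ℝ), Finset.sum_comm]
    refine Finset.sum_congr rfl fun j _ => ?_
    simp [S, T, PiLp.inner_apply, Matrix.toLpLin_apply, mul_comm]
  rw [h0, htr (T.isSymmetric_adjoint_comp_self.eigenvectorBasis finrank_euclideanSpace_fin),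
    nuclearNorm, Finset.sum_range, Finset.mul_sum]
  refine Finset.sum_le_sum fun j _ => (real_inner_le_norm _ _).trans ?_
  rw [LinearMap.norm_apply_eigenvectorBasis_adjoint_comp_self T]
  refine mul_le_mul_of_nonneg_right ?_ (T.singularValues_nonneg j)
  refine (norm_toEuclideanLin_apply_le A _).trans_eq ?_
  rw [OrthonormalBasis.norm_eq_one, mul_one]

theorem toEuclideanLin_vecMulVec_apply {m n : ℕ} (u : EuclideanSpace ℝ (Fin m))
    (v x : EuclideanSpace ℝ (Fin n)) :
    Matrix.toEuclideanLin (Matrix.vecMulVec u v) x = inner ℝ v x • u := by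
  ext i
  simp [Matrix.toLpLin_apply, PiLp.inner_apply, Matrix.mulVec, dotProduct, Matrix.vecMulVec_apply,
    Finset.sum_mul]
  exact Finset.sum_congr rfl fun j _ => by ring

theorem nuclearNorm_vecMulVec_le {m n : ℕ} (u : EuclideanSpace ℝ (Fin m))
    (v : EuclideanSpace ℝ (Fin n)) : nuclearNorm (Matrix.vecMulVec u v) ≤ ‖u‖ * ‖v‖ := by
  have hop : matrixOpNorm (Matrix.vecMulVec u v) ≤ ‖u‖ * ‖v‖ := by
    refine matrixOpNorm_le_of_forall (by positivity) fun x => ?_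
    rw [toEuclideanLin_vecMulVec_apply, norm_smul]
    calc ‖inner ℝ v x‖ * ‖u‖ ≤ (‖v‖ * ‖x‖) * ‖u‖ := by gcongr; exact norm_inner_le_norm v x
      _ = _ := by ring
  have hrank : Module.finrank ℝ (Matrix.toEuclideanLin (Matrix.vecMulVec u v)).range ≤ 1 := by
    refine (Submodule.finrank_mono (t := ℝ ∙ u) ?_).trans ((finrank_span_le_card _).trans (by simp))
    rintro _ ⟨x, rfl⟩
    rw [toEuclideanLin_vecMulVec_apply]
    exact Submodule.smul_mem _ _ (Submodule.mem_span_singleton_self u)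
  rcases n with _ | n
  · simp only [nuclearNorm, Finset.range_zero, Finset.sum_empty]; positivity
  · rw [nuclearNorm, Finset.sum_eq_single_of_mem 0 (by simp)]
    · exact (singularValues_le_matrixOpNorm _ (0 : Fin (n + 1))).trans hop
    · intro i _ hi
      rw [LinearMap.singularValues_eq_zero_iff_le_finrank_range]
      omega

/-! ### The dual of the slice nuclear norm -/

namespace Tensor3

variable {d₁ d₂ d₃ : ℕ}

theorem inner_eq_sum_slice (A B : Tensor3 d₁ d₂ d₃) :
    inner A B = ∑ k, ∑ i, ∑ j, slice A k i j * slice B k i j := by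
  rw [inner, Finset.sum_comm_cycle]
  simp [slice]

theorem matrixOpNorm_slice_le_maxSliceOpNorm (A : Tensor3 d₁ d₂ d₃) (k : Fin d₃) :
    matrixOpNorm (slice A k) ≤ maxSliceOpNorm A :=
  le_ciSup (f := fun k => matrixOpNorm (slice A k)) (Set.finite_range _).bddAbove k

theorem maxSliceOpNorm_nonneg (A : Tensor3 d₁ d₂ d₃) : 0 ≤ maxSliceOpNorm A :=
  Real.iSup_nonneg fun _ => matrixOpNorm_nonneg _

theorem inner_le_maxSliceOpNorm_mul (A B : Tensor3 d₁ d₂ d₃) :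
    inner A B ≤ maxSliceOpNorm A * sliceNuclearNorm B := by
  rw [inner_eq_sum_slice, sliceNuclearNorm, Finset.mul_sum]
  exact Finset.sum_le_sum fun k _ => (sum_mul_le_matrixOpNorm_mul_nuclearNorm _ _).trans
    (mul_le_mul_of_nonneg_right (matrixOpNorm_slice_le_maxSliceOpNorm A k) (nuclearNorm_nonneg _))

theorem inner_le_maxSliceOpNorm {A B : Tensor3 d₁ d₂ d₃} (hB : sliceNuclearNorm B ≤ 1) :
    inner A B ≤ maxSliceOpNorm A :=
  (inner_le_maxSliceOpNorm_mul A B).trans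
    (mul_le_of_le_one_right (maxSliceOpNorm_nonneg A) hB)

/-- The tensor whose `k`-th slice is `M` and whose other slices vanish. -/
def ofSlice (k : Fin d₃) (M : Matrix (Fin d₁) (Fin d₂) ℝ) : Tensor3 d₁ d₂ d₃ :=
  fun i j l => if l = k then M i j else 0

theorem slice_ofSlice_self (k : Fin d₃) (M : Matrix (Fin d₁) (Fin d₂) ℝ) :
    slice (ofSlice k M) k = M := by
  ext; simp [slice, ofSlice]

theorem slice_ofSlice_of_ne {k l : Fin d₃} (h : l ≠ k) (M : Matrix (Fin d₁) (Fin d₂) ℝ) :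
    slice (ofSlice k M) l = 0 := by
  ext; simp [slice, ofSlice, h]

theorem sliceNuclearNorm_ofSlice (k : Fin d₃) (M : Matrix (Fin d₁) (Fin d₂) ℝ) :
    sliceNuclearNorm (ofSlice k M) = nuclearNorm M := by
  rw [sliceNuclearNorm, Finset.sum_eq_single k, slice_ofSlice_self]
  · intro l _ hl
    rw [slice_ofSlice_of_ne hl, nuclearNorm_zero]
  · simp

theorem inner_ofSlice (A : Tensor3 d₁ d₂ d₃) (k : Fin d₃) (M : Matrix (Fin d₁) (Fin d₂) ℝ) :
    inner A (ofSlice k M) = ∑ i, ∑ j, slice A k i j * M i j := by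
  rw [inner_eq_sum_slice, Finset.sum_eq_single k, slice_ofSlice_self]
  · intro l _ hl
    simp [slice_ofSlice_of_ne hl]
  · simp

/-- The dual norm of the slice nuclear norm is the maximal slice operator norm. One inequality is
trace duality; for the other, the rank-one matrix proportional to `(A_{··k} x) xᵀ`, placed in the
`k`-th slice, shows `‖A_{··k} x‖ ≤ R^*(A) ‖x‖`. -/
theorem dualNorm_sliceNuclearNorm (A : Tensor3 d₁ d₂ d₃) :
    dualNorm sliceNuclearNorm A = maxSliceOpNorm A := by
  have hbdd : BddAbove {x : ℝ | ∃ B : Tensor3 d₁ d₂ d₃, sliceNuclearNorm B ≤ 1 ∧ x = inner A B} :=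
    ⟨maxSliceOpNorm A, by rintro _ ⟨B, hB, rfl⟩; exact inner_le_maxSliceOpNorm hB⟩
  have hzero : (0 : ℝ) ∈ {x : ℝ | ∃ B : Tensor3 d₁ d₂ d₃,
      sliceNuclearNorm B ≤ 1 ∧ x = inner A B} := by
    refine ⟨0, ?_, by simp [inner]⟩
    have : ∀ k, slice (0 : Tensor3 d₁ d₂ d₃) k = 0 := fun k => rfl
    simp [sliceNuclearNorm, this, nuclearNorm_zero]
  have hnonneg : 0 ≤ dualNorm sliceNuclearNorm A := le_csSup hbdd hzero
  refine le_antisymm (csSup_le ⟨0, hzero⟩ ?_) (Real.iSup_le (fun k => ?_) hnonneg)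
  · rintro _ ⟨B, hB, rfl⟩
    exact inner_le_maxSliceOpNorm hB
  · refine matrixOpNorm_le_of_forall hnonneg fun x => ?_
    set y := Matrix.toEuclideanLin (slice A k) x with hy
    rcases eq_or_ne y 0 with h0 | h0
    · rw [h0, norm_zero]; positivity
    have hx : x ≠ 0 := by rintro rfl; exact h0 (by simp [hy])
    have hy' : 0 < ‖y‖ := norm_pos_iff.2 h0
    have hx' : 0 < ‖x‖ := norm_pos_iff.2 hx
    set u := (‖y‖ * ‖x‖)⁻¹ • y with hu
    have hB : sliceNuclearNorm (ofSlice k (Matrix.vecMulVec u x) : Tensor3 d₁ d₂ d₃) ≤ 1 := by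
      rw [sliceNuclearNorm_ofSlice]
      refine (nuclearNorm_vecMulVec_le u x).trans_eq ?_
      rw [hu, norm_smul, Real.norm_of_nonneg (by positivity)]
      field_simp
    have hpair : inner A (ofSlice k (Matrix.vecMulVec u x)) = ‖y‖ / ‖x‖ := by
      have h1 : ∑ i, ∑ j, slice A k i j * Matrix.vecMulVec u x i j = Inner.inner ℝ u y := by
        rw [PiLp.inner_apply]
        refine Finset.sum_congr rfl fun i _ => ?_
        simp only [hy, Matrix.toLpLin_apply, Matrix.mulVec, dotProduct, Matrix.vecMulVec_apply,
          RCLike.inner_apply, conj_trivial, Finset.sum_mul]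
        exact Finset.sum_congr rfl fun j _ => by ring
      rw [inner_ofSlice, h1, hu, real_inner_smul_left, real_inner_self_eq_norm_sq]
      field_simp
    have h2 : ‖y‖ / ‖x‖ ≤ dualNorm sliceNuclearNorm A := le_csSup hbdd ⟨_, hB, hpair.symm⟩
    exact (div_le_iff₀ hx').1 h2

/-! ### The Frobenius norm -/

/-- The isometric identification of tensors under the Frobenius norm with a Euclidean space. -/
def toEuclidean : Tensor3 d₁ d₂ d₃ →ₗ[ℝ] EuclideanSpace ℝ (Fin d₁ × Fin d₂ × Fin d₃) where
  toFun A := WithLp.toLp 2 fun p => A p.1 p.2.1 p.2.2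
  map_add' _ _ := rfl
  map_smul' _ _ := rfl

theorem norm_toEuclidean (A : Tensor3 d₁ d₂ d₃) : ‖toEuclidean A‖ = frobNorm A := by
  rw [EuclideanSpace.norm_eq, frobNorm, inner]
  simp only [Fintype.sum_prod_type, Real.norm_eq_abs, sq, abs_mul_abs_self]
  rfl

theorem matrixOpNorm_slice_le_frobNorm (A : Tensor3 d₁ d₂ d₃) (k : Fin d₃) :
    matrixOpNorm (slice A k) ≤ frobNorm A := by
  refine matrixOpNorm_le_of_forall (Real.sqrt_nonneg _) fun x => ?_
  rw [EuclideanSpace.norm_eq x, frobNorm, ← Real.sqrt_mul', EuclideanSpace.norm_eq]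
  · refine Real.sqrt_le_sqrt ?_
    rw [inner, Finset.sum_mul]
    refine Finset.sum_le_sum fun i _ => ?_
    simp only [Matrix.toLpLin_apply, Matrix.mulVec, dotProduct, Real.norm_eq_abs, sq_abs]
    refine (Finset.sum_mul_sq_le_sq_mul_sq _ _ _).trans ?_
    gcongr with j
    rw [slice, Matrix.of_apply, sq]
    exact Finset.single_le_sum (f := fun k => A i j k * A i j k)
      (fun _ _ => mul_self_nonneg _) (Finset.mem_univ k)
  · positivity

theorem maxSliceOpNorm_le_frobNorm (A : Tensor3 d₁ d₂ d₃) : maxSliceOpNorm A ≤ frobNorm A :=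
  Real.iSup_le (matrixOpNorm_slice_le_frobNorm A) (Real.sqrt_nonneg _)

end Tensor3

/-! ### Azuma's inequality in Hilbert space -/

/-- The function `x ↦ cosh √x` is convex on `[0, ∞)`: its power series `∑ xⁿ / (2n)!` has
nonnegative coefficients. -/
theorem convexOn_cosh_sqrt : ConvexOn ℝ (Set.Ici 0) fun x : ℝ => Real.cosh √x := by
  have hs : ∀ x : ℝ, 0 ≤ x → HasSum (fun n : ℕ => x ^ n / ((2 * n).factorial : ℝ))
      (Real.cosh √x) := fun x hx => by
    simpa only [pow_mul, Real.sq_sqrt hx] using Real.hasSum_cosh √x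
  refine ⟨convex_Ici 0, fun x hx y hy a b ha hb hab => ?_⟩
  simp only [Set.mem_Ici] at hx hy
  refine hasSum_le (fun n => ?_) (hs (a • x + b • y) (by simp only [smul_eq_mul]; positivity))
    (((hs x hx).mul_left a).add ((hs y hy).mul_left b))
  have h := (convexOn_pow (𝕜 := ℝ) n).2 hx hy ha hb hab
  simp only [smul_eq_mul] at h ⊢
  calc (a * x + b * y) ^ n / ((2 * n).factorial : ℝ)
      ≤ (a * x ^ n + b * y ^ n) / ((2 * n).factorial : ℝ) := by gcongr
    _ = _ := by ring

/-- The chord of `u ↦ cosh √(r² + s² + 2rsu)` over `[-1, 1]`, whose endpoint values are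
`cosh (r ± s)`. -/
theorem cosh_sqrt_add_mul_le {r s u : ℝ} (hu : |u| ≤ 1) :
    Real.cosh √(r ^ 2 + s ^ 2 + 2 * (r * s * u)) ≤
      Real.cosh r * Real.cosh s + u * (Real.sinh r * Real.sinh s) := by
  obtain ⟨h1, h2⟩ := abs_le.1 hu
  have h := convexOn_cosh_sqrt.2 (sq_nonneg (r + s)) (sq_nonneg (r - s))
    (show 0 ≤ (1 + u) / 2 by linarith) (show 0 ≤ (1 - u) / 2 by linarith) (by ring)
  simp only [smul_eq_mul, Real.sqrt_sq_eq_abs, Real.cosh_abs, Real.cosh_add, Real.cosh_sub] at h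
  have harg : r ^ 2 + s ^ 2 + 2 * (r * s * u) =
      (1 + u) / 2 * (r + s) ^ 2 + (1 - u) / 2 * (r - s) ^ 2 := by ring
  rw [harg]
  exact h.trans_eq (by ring)

section Hilbert

variable {E : Type*} [NormedAddCommGroup E] [InnerProductSpace ℝ E]

/-- The one-step inequality behind the Azuma bound in Hilbert space. The increment `y` enters the
right-hand side linearly, so that a martingale difference contributes nothing on average. -/
theorem cosh_norm_add_le {a y : E} {b : ℝ} (hb : 0 < b) (hy : ‖y‖ ≤ b) :
    Real.cosh ‖a + y‖ ≤ Real.cosh b * Real.cosh ‖a‖ +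
      Real.sinh b / b * (Real.sinh ‖a‖ / ‖a‖ * inner ℝ a y) := by
  rcases eq_or_ne a 0 with rfl | ha
  · simpa using (abs_le_abs_of_nonneg (norm_nonneg y) hy)
  have ha' : 0 < ‖a‖ := norm_pos_iff.2 ha
  set u := inner ℝ a y / (‖a‖ * b) with hu
  have hu1 : |u| ≤ 1 := by
    rw [hu, abs_div, abs_of_pos (mul_pos ha' hb)]
    refine div_le_one_of_le₀ ((abs_real_inner_le_norm a y).trans ?_) (by positivity)
    gcongr
  have hin : ‖a‖ * b * u = inner ℝ a y := by rw [hu]; field_simp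
  have h1 : ‖a + y‖ ≤ √(‖a‖ ^ 2 + b ^ 2 + 2 * (‖a‖ * b * u)) := by
    refine Real.le_sqrt_of_sq_le ?_
    rw [norm_add_sq_real, hin]
    have : ‖y‖ ^ 2 ≤ b ^ 2 := by gcongr
    linarith
  calc Real.cosh ‖a + y‖ ≤ Real.cosh √(‖a‖ ^ 2 + b ^ 2 + 2 * (‖a‖ * b * u)) := by
        rw [Real.cosh_le_cosh, abs_of_nonneg (norm_nonneg _), abs_of_nonneg (Real.sqrt_nonneg _)]
        exact h1
    _ ≤ _ := cosh_sqrt_add_mul_le hu1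
    _ = _ := by rw [hu]; field_simp

variable {Ω : Type*} {mΩ : MeasurableSpace Ω} {P : Measure Ω}
  {ℱ : Filtration ℕ mΩ}

theorem stronglyMeasurable_sum_smul {D : ℕ → Ω → ℝ} {V : ℕ → Ω → E} {n : ℕ}
    (hV : ∀ t < n, StronglyMeasurable[ℱ t] (V t))
    (hD : ∀ t < n, StronglyMeasurable[ℱ (t + 1)] (D t)) :
    StronglyMeasurable[ℱ n] fun ω => ∑ t ∈ Finset.range n, D t ω • V t ω := by
  refine Finset.stronglyMeasurable_fun_sum _ fun t ht => ?_
  have ht' := Finset.mem_range.1 ht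
  exact ((hD t ht').mono (ℱ.mono ht')).smul ((hV t ht').mono (ℱ.mono ht'.le))

theorem ae_norm_sum_smul_le {D : ℕ → Ω → ℝ} {V : ℕ → Ω → E} {n : ℕ} {b : ℝ} (hb : 0 ≤ b)
    (hDb : ∀ t < n, ∀ᵐ ω ∂P, |D t ω| ≤ b) (hVb : ∀ t < n, ∀ᵐ ω ∂P, ‖V t ω‖ ≤ 1) :
    ∀ᵐ ω ∂P, ‖∑ t ∈ Finset.range n, D t ω • V t ω‖ ≤ n * b := by
  have h1 : ∀ᵐ ω ∂P, ∀ t < n, |D t ω| ≤ b := by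
    simpa only [ae_all_iff] using hDb
  have h2 : ∀ᵐ ω ∂P, ∀ t < n, ‖V t ω‖ ≤ 1 := by
    simpa only [ae_all_iff] using hVb
  filter_upwards [h1, h2] with ω h1 h2
  refine (norm_sum_le_of_le _ (f := fun t => D t ω • V t ω) (n := fun _ => b)
    fun t ht => ?_).trans_eq (by simp)
  have ht' := Finset.mem_range.1 ht
  rw [norm_smul, Real.norm_eq_abs]
  exact (mul_le_mul (h1 t ht') (h2 t ht') (norm_nonneg _) hb).trans_eq (mul_one b)

/-- Exponential moment bound for a Hilbert-space-valued martingale whose differences are bounded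
by `b`. The first conjunct keeps the integral from being a junk value. -/
theorem integral_cosh_norm_sum_smul_le [IsProbabilityMeasure P] {D : ℕ → Ω → ℝ}
    {V : ℕ → Ω → E} {b : ℝ} (hb : 0 < b) (n : ℕ)
    (hV : ∀ t < n, StronglyMeasurable[ℱ t] (V t))
    (hD : ∀ t < n, StronglyMeasurable[ℱ (t + 1)] (D t))
    (hDb : ∀ t < n, ∀ᵐ ω ∂P, |D t ω| ≤ b) (hVb : ∀ t < n, ∀ᵐ ω ∂P, ‖V t ω‖ ≤ 1)
    (hD0 : ∀ t < n, P[D t | ℱ t] =ᵐ[P] 0) :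
    Integrable (fun ω => Real.cosh ‖∑ t ∈ Finset.range n, D t ω • V t ω‖) P ∧
      ∫ ω, Real.cosh ‖∑ t ∈ Finset.range n, D t ω • V t ω‖ ∂P ≤ Real.cosh b ^ n := by
  have hint : ∀ k ≤ n,
      Integrable (fun ω => Real.cosh ‖∑ t ∈ Finset.range k, D t ω • V t ω‖) P := by
    intro k hk
    have hm := stronglyMeasurable_sum_smul (ℱ := ℱ) (n := k) (fun t ht => hV t (ht.trans_le hk))
      (fun t ht => hD t (ht.trans_le hk))
    refine Integrable.of_bound (C := Real.cosh (k * b))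
      (Real.continuous_cosh.comp_stronglyMeasurable
        (hm.mono (ℱ.le k)).norm).aestronglyMeasurable ?_
    filter_upwards [ae_norm_sum_smul_le hb.le (fun t ht => hDb t (ht.trans_le hk))
      (fun t ht => hVb t (ht.trans_le hk))] with ω hω
    rw [Real.norm_of_nonneg (Real.cosh_pos _).le, Real.cosh_le_cosh, abs_norm]
    exact hω.trans (le_abs_self _)
  refine ⟨hint n le_rfl, ?_⟩
  induction n with
  | zero => simp
  | succ n ih =>
    specialize ih (fun t ht => hV t (by omega)) (fun t ht => hD t (by omega))
      (fun t ht => hDb t (by omega)) (fun t ht => hVb t (by omega)) (fun t ht => hD0 t (by omega))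
      (fun k hk => hint k (by omega))
    set S : Ω → E := fun ω => ∑ t ∈ Finset.range n, D t ω • V t ω with hS
    have hSm : StronglyMeasurable[ℱ n] S :=
      stronglyMeasurable_sum_smul (fun t ht => hV t (by omega)) (fun t ht => hD t (by omega))
    have hSb : ∀ᵐ ω ∂P, ‖S ω‖ ≤ n * b :=
      ae_norm_sum_smul_le hb.le (fun t ht => hDb t (by omega)) (fun t ht => hVb t (by omega))
    -- The predictable factor multiplying the scalar martingale difference `D n`.
    set h : Ω → ℝ := fun ω => Real.sinh ‖S ω‖ / ‖S ω‖ * inner ℝ (S ω) (V n ω) with hh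
    have hhm : StronglyMeasurable[ℱ n] h :=
      ((Real.continuous_sinh.comp_stronglyMeasurable hSm.norm).measurable.div
        hSm.norm.measurable).stronglyMeasurable.mul
        (hSm.inner (hV n (by omega)))
    have hhb : ∀ᵐ ω ∂P, ‖h ω‖ ≤ Real.sinh (n * b) := by
      filter_upwards [hSb, hVb n (by omega)] with ω h1 h2
      rcases eq_or_ne (S ω) 0 with h0 | h0
      · simp only [hh, h0]; simp [Real.sinh_nonneg_iff]; positivity
      have hpos : 0 < ‖S ω‖ := norm_pos_iff.2 h0
      have hsh : 0 ≤ Real.sinh ‖S ω‖ := Real.sinh_nonneg_iff.2 hpos.le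
      calc ‖h ω‖ = Real.sinh ‖S ω‖ / ‖S ω‖ * |inner ℝ (S ω) (V n ω)| := by
            rw [hh, Real.norm_eq_abs, abs_mul, abs_of_nonneg (by positivity)]
        _ ≤ Real.sinh ‖S ω‖ / ‖S ω‖ * (‖S ω‖ * 1) := by
            gcongr
            exact (abs_real_inner_le_norm _ _).trans (by gcongr)
        _ = Real.sinh ‖S ω‖ := by field_simp
        _ ≤ _ := Real.sinh_le_sinh.2 h1
    have hDint : Integrable (D n) P := Integrable.of_bound
      ((hD n (by omega)).mono (ℱ.le _)).aestronglyMeasurable b (hDb n (by omega))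
    have hhD : Integrable (fun ω => h ω * D n ω) P :=
      hDint.bdd_mul (hhm.mono (ℱ.le n)).aestronglyMeasurable hhb
    have hzero : ∫ ω, h ω * D n ω ∂P = 0 := by
      have h1 : P[h * D n | ℱ n] =ᵐ[P] 0 := by
        filter_upwards [condExp_stronglyMeasurable_mul_of_bound (ℱ.le n) hhm hDint _ hhb,
          hD0 n (by omega)] with ω h2 h3
        simp [h2, h3]
      rw [← integral_condExp (ℱ.le n) (f := fun ω => h ω * D n ω)]
      exact (integral_congr_ae h1).trans (by simp)
    have hstep : ∀ᵐ ω ∂P, Real.cosh ‖∑ t ∈ Finset.range (n + 1), D t ω • V t ω‖ ≤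
        Real.cosh b * Real.cosh ‖S ω‖ + Real.sinh b / b * (h ω * D n ω) := by
      filter_upwards [hDb n (by omega), hVb n (by omega)] with ω h1 h2
      rw [Finset.sum_range_succ]
      refine (cosh_norm_add_le (a := S ω) hb ?_).trans_eq ?_
      · rw [norm_smul, Real.norm_eq_abs]
        exact (mul_le_mul h1 h2 (norm_nonneg _) hb.le).trans_eq (mul_one b)
      · rw [real_inner_smul_right]; ring
    calc ∫ ω, Real.cosh ‖∑ t ∈ Finset.range (n + 1), D t ω • V t ω‖ ∂P
        ≤ ∫ ω, (Real.cosh b * Real.cosh ‖S ω‖ + Real.sinh b / b * (h ω * D n ω)) ∂P :=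
          integral_mono_ae (hint _ le_rfl)
            (((hint n (by omega)).const_mul _).add (hhD.const_mul _)) hstep
      _ = Real.cosh b * ∫ ω, Real.cosh ‖S ω‖ ∂P := by
          rw [integral_add ((hint n (by omega)).const_mul _) (hhD.const_mul _),
            integral_const_mul, integral_const_mul, hzero, mul_zero, add_zero]
      _ ≤ Real.cosh b * Real.cosh b ^ n := by gcongr
      _ = _ := by ring

/-- Dimension-free **Azuma inequality** in Hilbert space, for differences `D t • V t` that are the
product of a predictable vector `V t` in the unit ball and a scalar martingale difference `D t` with
`|D t| ≤ b`. Keeping the randomness of the increment scalar avoids vector-valued conditional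
expectations. -/
theorem measureReal_le_norm_sum_smul_le [IsProbabilityMeasure P] {D : ℕ → Ω → ℝ}
    {V : ℕ → Ω → E} {b u : ℝ} (hb : 0 < b) (hu : 0 < u) {n : ℕ} (hn : 0 < n)
    (hV : ∀ t < n, StronglyMeasurable[ℱ t] (V t))
    (hD : ∀ t < n, StronglyMeasurable[ℱ (t + 1)] (D t))
    (hDb : ∀ t < n, ∀ᵐ ω ∂P, |D t ω| ≤ b) (hVb : ∀ t < n, ∀ᵐ ω ∂P, ‖V t ω‖ ≤ 1)
    (hD0 : ∀ t < n, P[D t | ℱ t] =ᵐ[P] 0) :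
    P.real {ω | u ≤ ‖∑ t ∈ Finset.range n, D t ω • V t ω‖} ≤
      2 * Real.exp (-u ^ 2 / (2 * n * b ^ 2)) := by
  have hn' : (0 : ℝ) < n := Nat.cast_pos.2 hn
  -- The optimal exponent `θ` for the moment bound `E cosh (θ‖S‖) ≤ exp (n θ² b² / 2)`.
  set θ : ℝ := u / (n * b ^ 2) with hθ
  have hθ0 : 0 < θ := by positivity
  obtain ⟨hint, hle⟩ := integral_cosh_norm_sum_smul_le (P := P) (ℱ := ℱ)
    (D := fun t ω => θ * D t ω) (mul_pos hθ0 hb) n hV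
    (fun t ht => (hD t ht).const_mul θ)
    (fun t ht => by
      filter_upwards [hDb t ht] with ω h
      rw [abs_mul, abs_of_pos hθ0]
      gcongr) hVb
    (fun t ht => by
      filter_upwards [condExp_smul (μ := P) θ (D t) (ℱ t), hD0 t ht] with ω h1 h2
      exact h1.trans (by simp [h2]))
  have hnorm : ∀ ω, ‖∑ t ∈ Finset.range n, (θ * D t ω) • V t ω‖ =
      θ * ‖∑ t ∈ Finset.range n, D t ω • V t ω‖ := fun ω => by
    simp_rw [mul_smul]
    rw [← Finset.smul_sum, norm_smul, Real.norm_of_nonneg hθ0.le]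
  simp only [hnorm] at hint hle
  have hmarkov := mul_meas_ge_le_integral_of_nonneg (ae_of_all _ fun ω => (Real.cosh_pos _).le)
    hint (Real.cosh (θ * u))
  have hset : P.real {ω | u ≤ ‖∑ t ∈ Finset.range n, D t ω • V t ω‖} ≤
      P.real {ω | Real.cosh (θ * u) ≤
        Real.cosh (θ * ‖∑ t ∈ Finset.range n, D t ω • V t ω‖)} := by
    refine measureReal_mono fun ω hω => ?_
    simp only [Set.mem_ofPred_eq] at hω ⊢
    rw [Real.cosh_le_cosh, abs_of_pos (by positivity), abs_of_nonneg (by positivity)]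
    gcongr
  have hcosh : Real.exp (θ * u) / 2 ≤ Real.cosh (θ * u) := by
    rw [Real.cosh_eq]
    have := Real.exp_pos (-(θ * u))
    linarith
  have hpow : Real.cosh (θ * b) ^ n ≤ Real.exp (n * ((θ * b) ^ 2 / 2)) := by
    rw [Real.exp_nat_mul]
    exact pow_le_pow_left₀ (Real.cosh_pos _).le (Real.cosh_le_exp_half_sq _) n
  set p := P.real {ω | u ≤ ‖∑ t ∈ Finset.range n, D t ω • V t ω‖}
  have h1 : Real.exp (θ * u) / 2 * p ≤ Real.exp (n * ((θ * b) ^ 2 / 2)) :=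
    calc Real.exp (θ * u) / 2 * p ≤ Real.cosh (θ * u) * p := by gcongr
      _ ≤ Real.cosh (θ * u) * _ := by gcongr
      _ ≤ _ := hmarkov.trans (hle.trans hpow)
  have h2 : -u ^ 2 / (2 * n * b ^ 2) = n * ((θ * b) ^ 2 / 2) - θ * u := by
    rw [hθ]; field_simp; ring
  rw [h2, Real.exp_sub, ← mul_div_assoc, le_div_iff₀ (Real.exp_pos _)]
  linarith

end Hilbert

/-! ### Truncation of sub-Gaussian noise -/

/-- Beyond the level `B`, the identity is dominated by exponentials that carry a factor `e^{-sB}`. -/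
theorem abs_sub_truncation_le {α : Type*} (f : α → ℝ) {s : ℝ} (hs : 0 < s) (B : ℝ) (x : α) :
    |f x - truncation f B x| ≤
      s⁻¹ * Real.exp (-(s * B)) * (Real.exp (2 * s * f x) + Real.exp (-(2 * s) * f x)) := by
  by_cases hx : f x ∈ Set.Ioc (-B) B
  · simp only [truncation, Function.comp_apply, Set.indicator_of_mem hx, id_eq, sub_self, abs_zero]
    positivity
  · simp only [truncation, Function.comp_apply, Set.indicator_of_notMem hx, sub_zero]
    have hB : B ≤ |f x| := by
      by_contra! h
      exact hx ⟨(abs_lt.1 h).1, (abs_lt.1 h).2.le⟩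
    have h1 : s * |f x| ≤ Real.exp (s * |f x|) :=
      (by linarith : s * |f x| ≤ s * |f x| + 1).trans (Real.add_one_le_exp _)
    have h2 : Real.exp (s * |f x|) ≤ Real.exp (-(s * B)) * Real.exp (2 * s * |f x|) := by
      rw [← Real.exp_add]
      refine Real.exp_le_exp.2 ?_
      nlinarith [mul_le_mul_of_nonneg_left hB hs.le]
    have h3 : Real.exp (2 * s * |f x|) ≤ Real.exp (2 * s * f x) + Real.exp (-(2 * s) * f x) := by
      rcases abs_choice (f x) with h | h <;> rw [h]
      · linarith [Real.exp_pos (-(2 * s) * f x)]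
      · rw [mul_neg, ← neg_mul]
        linarith [Real.exp_pos (2 * s * f x)]
    calc |f x| = s⁻¹ * (s * |f x|) := by field_simp
      _ ≤ s⁻¹ * (Real.exp (-(s * B)) * Real.exp (2 * s * |f x|)) := 
        mul_le_mul_of_nonneg_left (h1.trans h2) (by positivity)
      _ ≤ s⁻¹ * (Real.exp (-(s * B)) * (Real.exp (2 * s * f x) + Real.exp (-(2 * s) * f x))) := by
        gcongr
      _ = _ := by ring

section Noise

variable {Ω : Type*} {mΩ : MeasurableSpace Ω} {P : Measure Ω} {ℱ : Filtration ℕ mΩ}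

/-- Truncating a sub-Gaussian variable at the level `4 R √L` costs little in `L¹`. -/
theorem integral_abs_sub_truncation_le [IsProbabilityMeasure P] {Y : Ω → ℝ} {R : ℝ≥0}
    (hR : 0 < R) (hY : HasSubgaussianMGF Y (R ^ 2) P) {L : ℝ} (hL : 1 ≤ L) :
    ∫ ω, |Y ω - truncation Y (4 * R * √L) ω| ∂P ≤ 2 * R * Real.exp (-(2 * L)) := by
  have hR' : (0 : ℝ) < R := hR
  have hsL : 1 ≤ √L := Real.one_le_sqrt.2 hL
  have hsq : √L ^ 2 = L := Real.sq_sqrt (by linarith)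
  set s : ℝ := √L / R with hs
  have hs0 : 0 < s := by positivity
  have hsR : s * R = √L := by rw [hs]; field_simp
  have hsB : s * (4 * R * √L) = 4 * L := by
    calc s * (4 * R * √L) = 4 * (s * R) * √L := by ring
      _ = 4 * L := by rw [hsR, ← hsq, Real.sqrt_sq (by positivity)]; ring
  have hmgf : ∀ t : ℝ, t ^ 2 = (2 * s) ^ 2 → ∫ ω, Real.exp (t * Y ω) ∂P ≤ Real.exp (2 * L) := by
    intro t ht
    refine (hY.mgf_le t).trans_eq ?_
    congr 1
    push_cast
    rw [ht, ← hsq, ← hsR]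
    ring
  have hi := hY.integrable_exp_mul
  have hsinv : s⁻¹ ≤ R := by
    rw [hs, inv_div]
    exact div_le_self hR'.le hsL
  calc ∫ ω, |Y ω - truncation Y (4 * R * √L) ω| ∂P
      ≤ ∫ ω, s⁻¹ * Real.exp (-(s * (4 * R * √L))) *
          (Real.exp (2 * s * Y ω) + Real.exp (-(2 * s) * Y ω)) ∂P :=
        integral_mono_of_nonneg (ae_of_all _ fun ω => abs_nonneg _)
          (((hi _).add (hi _)).const_mul _) (ae_of_all _ (abs_sub_truncation_le Y hs0 _))
    _ = s⁻¹ * Real.exp (-(4 * L)) *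
          (∫ ω, Real.exp (2 * s * Y ω) ∂P + ∫ ω, Real.exp (-(2 * s) * Y ω) ∂P) := by
        rw [integral_const_mul, integral_add (hi _) (hi _), hsB]
    _ ≤ R * Real.exp (-(4 * L)) * (Real.exp (2 * L) + Real.exp (2 * L)) := by
        gcongr
        · exact hmgf _ rfl
        · exact hmgf _ (by ring)
    _ = 2 * R * (Real.exp (-(4 * L)) * Real.exp (2 * L)) := by ring
    _ = _ := by rw [← Real.exp_add]; congr 2; ring

theorem stronglyMeasurable_truncation {m : MeasurableSpace Ω} {Y : Ω → ℝ} (hY : Measurable Y)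
    (B : ℝ) : StronglyMeasurable (truncation Y B) :=
  ((measurable_id.indicator measurableSet_Ioc).comp hY).stronglyMeasurable

/-- If `Y` has conditional mean zero, the conditional mean of a truncation of `Y` is, up to sign,
that of the discarded part. -/
theorem integral_abs_condExp_truncation_le [IsProbabilityMeasure P] {m : MeasurableSpace Ω}
    {Y : Ω → ℝ} (hY : Integrable Y P) (h0 : P[Y | m] =ᵐ[P] 0) (B : ℝ) :
    ∫ ω, |P[truncation Y B | m] ω| ∂P ≤ ∫ ω, |Y ω - truncation Y B ω| ∂P := by
  have hT : Integrable (truncation Y B) P := hY.1.integrable_truncation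
  have h1 : (fun ω => |P[truncation Y B | m] ω|) =ᵐ[P]
      fun ω => |P[Y - truncation Y B | m] ω| := by
    filter_upwards [condExp_sub hY hT m, h0] with ω h2 h3
    rw [h2, Pi.sub_apply, h3, Pi.zero_apply, zero_sub, abs_neg]
  rw [integral_congr_ae h1]
  exact integral_abs_condExp_le _

variable {E : Type*} [NormedAddCommGroup E] [InnerProductSpace ℝ E]

/-- Concentration of `∑ ε_t V_t` in Hilbert space when `ε_t` is sub-Gaussian and has conditional mean
zero, but need not be conditionally sub-Gaussian. With `ξ_t` the truncation of `ε_t` at `4 R √L`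
and `m_t = E(ξ_t | ℱ_t)`, the sum splits into the martingale `∑ (ξ_t - m_t) V_t` with bounded
differences and a remainder of norm at most `∑ (|ε_t - ξ_t| + |m_t|)`, which is small in `L¹`. -/
theorem measureReal_le_norm_sum_noise_smul_le [IsProbabilityMeasure P] {ε : ℕ → Ω → ℝ}
    {V : ℕ → Ω → E} {R : ℝ≥0} (hR : 0 < R) {n : ℕ} (hn : 0 < n) {L l : ℝ} (hL : 1 ≤ L) (hl : 0 < l)
    (hV : ∀ t < n, StronglyMeasurable[ℱ t] (V t)) (hVb : ∀ t < n, ∀ᵐ ω ∂P, ‖V t ω‖ ≤ 1)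
    (hε : ∀ t < n, Measurable[ℱ (t + 1)] (ε t)) (hε0 : ∀ t < n, P[ε t | ℱ t] =ᵐ[P] 0)
    (hεR : ∀ t < n, HasSubgaussianMGF (ε t) (R ^ 2) P) :
    P.real {ω | R + 8 * R * √L * √(2 * n * l) ≤ ‖∑ t ∈ Finset.range n, ε t ω • V t ω‖} ≤
      4 * n * Real.exp (-(2 * L)) + 2 * Real.exp (-l) := by
  have hR' : (0 : ℝ) < R := hR
  have hn' : (0 : ℝ) < n := Nat.cast_pos.2 hn
  have hL0 : 0 < √L := Real.sqrt_pos.2 (by linarith)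
  set B : ℝ := 4 * R * √L with hB
  have hB0 : 0 < B := by positivity
  set ξ : ℕ → Ω → ℝ := fun t => truncation (ε t) B with hξ
  set m : ℕ → Ω → ℝ := fun t => P[ξ t | ℱ t] with hm
  have hξb : ∀ t ω, |ξ t ω| ≤ B := fun t ω =>
    (abs_truncation_le_bound _ _ _).trans_eq (abs_of_pos hB0)
  have hξm : ∀ t < n, StronglyMeasurable[ℱ (t + 1)] (ξ t) := fun t ht =>
    stronglyMeasurable_truncation (hε t ht) B
  have hξi : ∀ t < n, Integrable (ξ t) P := fun t ht => (hεR t ht).integrable.1.integrable_truncation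
  have hmm : ∀ t, StronglyMeasurable[ℱ t] (m t) := fun t => stronglyMeasurable_condExp
  have hmi : ∀ t, Integrable (m t) P := fun t => integrable_condExp
  -- Since `|ξ_t| ≤ B` and hence `|m_t| ≤ B`, the differences `ξ_t - m_t` are bounded by `2 B`; the
  -- threshold `u` is chosen to make the exponent in the Azuma bound equal to `-l`.
  have hmart := measureReal_le_norm_sum_smul_le (P := P) (ℱ := ℱ) (V := V)
    (D := fun t ω => ξ t ω - m t ω) (b := 2 * B) (u := 2 * B * √(2 * n * l))
    (by positivity) (by positivity) hn hV
    (fun t ht => (hξm t ht).sub ((hmm t).mono (ℱ.mono t.le_succ)))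
    (fun t ht => by
      have h1 : ∀ᵐ ω ∂P, |m t ω| ≤ B :=
        ae_bdd_abs_condExp_of_ae_bdd_abs (ae_of_all _ (hξb t))
      filter_upwards [h1] with ω h1
      calc |ξ t ω - m t ω| ≤ |ξ t ω| + |m t ω| := abs_sub _ _
        _ ≤ B + B := add_le_add (hξb t ω) h1
        _ = 2 * B := by ring)
    hVb
    (fun t ht => by
      filter_upwards [condExp_sub (hξi t ht) (hmi t) (ℱ t)] with ω h1
      refine h1.trans ?_
      rw [condExp_of_stronglyMeasurable (ℱ.le t) (hmm t) (hmi t)]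
      simp [hm])
  have hexp : -(2 * B * √(2 * n * l)) ^ 2 / (2 * n * (2 * B) ^ 2) = -l := by
    rw [mul_pow, Real.sq_sqrt (by positivity)]
    field_simp
  rw [hexp] at hmart
  -- The remainder `W` includes the event that some `|ε_t|` exceeds `B`, so Markov's inequality
  -- for `W` replaces a separate union bound for that event.
  set W : Ω → ℝ := fun ω => ∑ t ∈ Finset.range n, (|ε t ω - ξ t ω| + |m t ω|) with hW
  have hi1 : ∀ t < n, Integrable (fun ω => |ε t ω - ξ t ω|) P := fun t ht =>
    ((hεR t ht).integrable.sub (hξi t ht)).abs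
  have hi2 : ∀ t < n, Integrable (fun ω => |ε t ω - ξ t ω| + |m t ω|) P := fun t ht =>
    (hi1 t ht).add (hmi t).abs
  have hWi : Integrable W P := integrable_finsetSum _ fun t ht => hi2 t (Finset.mem_range.1 ht)
  have hW0 : 0 ≤ W := fun ω => Finset.sum_nonneg fun t _ => by positivity
  have hWint : ∫ ω, W ω ∂P ≤ R * (4 * n * Real.exp (-(2 * L))) := by
    rw [hW, integral_finsetSum _ fun t ht => hi2 t (Finset.mem_range.1 ht)]
    have hterm : ∀ t ∈ Finset.range n, ∫ ω, (|ε t ω - ξ t ω| + |m t ω|) ∂P ≤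
        4 * R * Real.exp (-(2 * L)) := by
      intro t ht
      have ht' := Finset.mem_range.1 ht
      rw [integral_add (hi1 t ht') (hmi t).abs]
      have h1 := integral_abs_sub_truncation_le hR (hεR t ht') hL
      have h2 := integral_abs_condExp_truncation_le (hεR t ht').integrable (hε0 t ht') B
      linarith
    refine (Finset.sum_le_sum hterm).trans_eq ?_
    simp only [Finset.sum_const, Finset.card_range, nsmul_eq_mul]
    ring
  have hmarkov : P.real {ω | (R : ℝ) ≤ W ω} ≤ 4 * n * Real.exp (-(2 * L)) :=
    le_of_mul_le_mul_left
      ((mul_meas_ge_le_integral_of_nonneg (ae_of_all _ hW0) hWi R).trans hWint) hR'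
  have hsub : {ω | R + 8 * R * √L * √(2 * n * l) ≤ ‖∑ t ∈ Finset.range n, ε t ω • V t ω‖} ≤ᵐ[P]
      ({ω | (R : ℝ) ≤ W ω} ∪ {ω | 2 * B * √(2 * n * l) ≤
        ‖∑ t ∈ Finset.range n, (ξ t ω - m t ω) • V t ω‖} : Set Ω) := by
    have h2 : ∀ᵐ ω ∂P, ∀ t < n, ‖V t ω‖ ≤ 1 := by
      simpa only [ae_all_iff] using hVb
    filter_upwards [h2] with ω hω
    intro (hle : R + 8 * R * √L * √(2 * n * l) ≤ ‖∑ t ∈ Finset.range n, ε t ω • V t ω‖)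
    change (R : ℝ) ≤ W ω ∨ 2 * B * √(2 * n * l) ≤
      ‖∑ t ∈ Finset.range n, (ξ t ω - m t ω) • V t ω‖
    by_contra! hcon
    have hsplit : ∑ t ∈ Finset.range n, ε t ω • V t ω =
        ∑ t ∈ Finset.range n, (ξ t ω - m t ω) • V t ω +
          ∑ t ∈ Finset.range n, (ε t ω - ξ t ω + m t ω) • V t ω := by
      rw [← Finset.sum_add_distrib]
      refine Finset.sum_congr rfl fun t _ => ?_
      rw [← add_smul]
      congr 1
      ring
    have hrem : ‖∑ t ∈ Finset.range n, (ε t ω - ξ t ω + m t ω) • V t ω‖ ≤ W ω := by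
      refine norm_sum_le_of_le _ fun t ht => ?_
      rw [norm_smul, Real.norm_eq_abs]
      calc |ε t ω - ξ t ω + m t ω| * ‖V t ω‖ ≤ |ε t ω - ξ t ω + m t ω| * 1 := by
            gcongr
            exact hω t (Finset.mem_range.1 ht)
        _ ≤ _ := by rw [mul_one]; exact abs_add_le _ _
    have h3 := (hsplit ▸ norm_add_le _ _ : ‖∑ t ∈ Finset.range n, ε t ω • V t ω‖ ≤ _)
    have h4 : 8 * R * √L * √(2 * n * l) = 2 * B * √(2 * n * l) := by rw [hB]; ring
    linarith [hcon.1, hcon.2]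
  calc P.real {ω | R + 8 * R * √L * √(2 * n * l) ≤ ‖∑ t ∈ Finset.range n, ε t ω • V t ω‖}
      ≤ P.real ({ω | (R : ℝ) ≤ W ω} ∪ {ω | 2 * B * √(2 * n * l) ≤
        ‖∑ t ∈ Finset.range n, (ξ t ω - m t ω) • V t ω‖}) :=
        ENNReal.toReal_mono (measure_ne_top _ _) (measure_mono_ae hsub)
    _ ≤ _ := (measureReal_union_le _ _).trans (add_le_add hmarkov hmart)

/-! ### The noise average of an exploration phase -/

namespace Tensor3

variable {d₁ d₂ d₃ : ℕ}

theorem dualNorm_sliceNuclearNorm_le_norm_toEuclidean (A : Tensor3 d₁ d₂ d₃) :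
    dualNorm sliceNuclearNorm A ≤ ‖toEuclidean A‖ := by
  rw [dualNorm_sliceNuclearNorm, norm_toEuclidean]
  exact maxSliceOpNorm_le_frobNorm A

theorem norm_toEuclidean_noiseAverage (T : ℕ) (X : ℕ → Ω → Tensor3 d₁ d₂ d₃) (ε : ℕ → Ω → ℝ)
    (ω : Ω) : ‖toEuclidean (noiseAverage T X ε ω)‖ =
      (1 / T) * ‖∑ t ∈ Finset.range T, ε t ω • toEuclidean (X t ω)‖ := by
  rw [noiseAverage, map_smul, norm_smul, map_sum, Real.norm_of_nonneg (by positivity)]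
  simp_rw [map_smul]

theorem continuous_toEuclidean :
    Continuous (toEuclidean : Tensor3 d₁ d₂ d₃ → EuclideanSpace ℝ (Fin d₁ × Fin d₂ × Fin d₃)) :=
  LinearMap.continuous_of_finiteDimensional toEuclidean

end Tensor3

/-- The deviation threshold of the concentration bound, averaged over the rounds, is at most the
regularization parameter with `c = 13`, because `8 √2 ≤ 12`. -/
theorem threshold_div_le_regParam {α R δ : ℝ} (hα : 0 ≤ α) (hR : 0 ≤ R) {T d : ℕ} (hT : 0 < T)
    (hL : 1 ≤ Real.log (4 * T * d / δ)) (hl : 1 ≤ Real.log (4 * d / δ)) :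
    α * (1 / T * (R + 8 * R * √(Real.log (4 * T * d / δ)) * √(2 * T * Real.log (4 * d / δ)))) ≤
      regParam 13 α R T d δ := by
  set L := Real.log (4 * T * d / δ)
  set l := Real.log (4 * d / δ)
  have hT' : (1 : ℝ) ≤ T := Nat.one_le_cast.2 hT
  have h2 : √2 ≤ 3 / 2 := Real.sqrt_le_iff.2 ⟨by norm_num, by norm_num⟩
  have hsT : 1 ≤ √(T : ℝ) := Real.one_le_sqrt.2 hT'
  have hLl : 1 ≤ √(L * l) := Real.one_le_sqrt.2 (one_le_mul_of_one_le_of_one_le hL hl)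
  have hsplit : √L * √(2 * T * l) = √2 * (√(T : ℝ) * √(L * l)) := by
    rw [← Real.sqrt_mul (by linarith), ← Real.sqrt_mul (by linarith), ← Real.sqrt_mul (by norm_num)]
    congr 1
    ring
  have h1 : 1 ≤ √(T : ℝ) * √(L * l) := one_le_mul_of_one_le_of_one_le hsT hLl
  have hsq : (T : ℝ) = √T * √T := (Real.mul_self_sqrt (by linarith)).symm
  calc α * (1 / T * (R + 8 * R * √L * √(2 * T * l)))
      = α * (1 / T * (R * 1 + 8 * R * (√2 * (√(T : ℝ) * √(L * l))))) := by
        rw [← hsplit]; ring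
    _ ≤ α * (1 / T * (R * (√(T : ℝ) * √(L * l)) + 8 * R * (3 / 2 * (√(T : ℝ) * √(L * l))))) := by
        gcongr
    _ = 13 * α * R * (√T / T) * √(L * l) := by ring
    _ = _ := by
        have : √(T : ℝ) / T = 1 / √T := by
          rw [Real.sqrt_div_self]
          simp
        rw [this, regParam]
        ring

/-- The failure probability of the concentration bound is at most `δ`. -/
theorem failure_probability_le {δ : ℝ} (hδ : 0 < δ) (hδ1 : δ < 1) {T d : ℕ} (hT : 0 < T)
    (hd : 0 < d) :
    4 * T * Real.exp (-(2 * Real.log (4 * T * d / δ))) + 2 * Real.exp (-Real.log (4 * d / δ)) ≤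
      δ := by
  have hT' : (1 : ℝ) ≤ T := Nat.one_le_cast.2 hT
  have hd' : (1 : ℝ) ≤ d := Nat.one_le_cast.2 hd
  have hT0 : (0 : ℝ) < T := by linarith
  have hd0 : (0 : ℝ) < d := by linarith
  have h1 : Real.exp (-(2 * Real.log (4 * T * d / δ))) = (δ / (4 * T * d)) ^ 2 := by
    rw [two_mul, neg_add, Real.exp_add, Real.exp_neg, Real.exp_log (by positivity), inv_div, sq]
  have h2 : Real.exp (-Real.log (4 * d / δ)) = δ / (4 * d) := by
    rw [Real.exp_neg, Real.exp_log (by positivity), inv_div]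
  have h3 : δ / (4 * T * d) ≤ δ / (4 * T) :=
    div_le_div_of_nonneg_left hδ.le (by positivity) (by nlinarith)
  have h4 : δ / (4 * T) ≤ 1 / 4 := by
    rw [div_le_div_iff₀ (by positivity) (by positivity)]; nlinarith
  have h5 : δ / (4 * d) ≤ δ / 4 := div_le_div_of_nonneg_left hδ.le (by positivity) (by linarith)
  have h6 : 4 * T * (δ / (4 * T * d)) ^ 2 ≤ δ / 4 :=
    calc 4 * T * (δ / (4 * T * d)) ^ 2 ≤ 4 * T * (δ / (4 * T) * (1 / 4)) := by
          rw [sq]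
          exact mul_le_mul_of_nonneg_left (mul_le_mul h3 (h3.trans h4) (by positivity)
            (by positivity)) (by positivity)
      _ = δ / 4 := by field_simp
  rw [h1, h2]
  linarith

theorem one_le_log_four_mul_div {δ x : ℝ} (hδ : 0 < δ) (hδ1 : δ < 1) (hx : 1 ≤ x) :
    1 ≤ Real.log (4 * x / δ) := by
  rw [Real.le_log_iff_exp_le (by positivity), le_div_iff₀ hδ]
  have := Real.exp_one_lt_d9
  have := Real.exp_pos 1
  nlinarith

/-- The high-probability bound, with the constant `c = 13`. The dual norm is bounded by the
Frobenius norm, for which the concentration bound holds without a dimension factor, so any `d ≥ 1`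
may be used in the logarithms. -/
theorem IsExploration.one_sub_le_measureReal [IsProbabilityMeasure P] {d₁ d₂ d₃ : ℕ}
    {T d : ℕ} (hT : 0 < T) (hd : 0 < d) {R : ℝ≥0} {α : ℝ} (hα : 0 ≤ α) {δ : ℝ} (hδ : 0 < δ)
    (hδ1 : δ < 1) {X : ℕ → Ω → Tensor3 d₁ d₂ d₃} {ε : ℕ → Ω → ℝ}
    (h : IsExploration P ℱ R T X ε) :
    1 - δ ≤ P.real {ω | α * Tensor3.dualNorm Tensor3.sliceNuclearNorm (noiseAverage T X ε ω) ≤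
      regParam 13 α R T d δ} := by
  have hT' : (1 : ℝ) ≤ T := Nat.one_le_cast.2 hT
  have hd' : (1 : ℝ) ≤ d := Nat.one_le_cast.2 hd
  have hbound : ∀ ω, Tensor3.dualNorm Tensor3.sliceNuclearNorm (noiseAverage T X ε ω) ≤
      1 / T * ‖∑ t ∈ Finset.range T, ε t ω • Tensor3.toEuclidean (X t ω)‖ := fun ω =>
    (Tensor3.dualNorm_sliceNuclearNorm_le_norm_toEuclidean _).trans_eq
      (Tensor3.norm_toEuclidean_noiseAverage T X ε ω)
  set good := {ω | α * Tensor3.dualNorm Tensor3.sliceNuclearNorm (noiseAverage T X ε ω) ≤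
    regParam 13 α R T d δ} with hgood
  have hL : 1 ≤ Real.log (4 * T * d / δ) := by
    rw [mul_assoc]
    exact one_le_log_four_mul_div hδ hδ1 (one_le_mul_of_one_le_of_one_le hT' hd')
  have hl : 1 ≤ Real.log (4 * d / δ) := one_le_log_four_mul_div hδ hδ1 hd'
  rcases eq_or_ne R 0 with rfl | hR0
  · -- Noise with variance proxy zero vanishes almost surely.
    have hε : ∀ᵐ ω ∂P, ∀ t < T, ε t ω = 0 := by
      simp only [ae_all_iff]
      intro t ht
      have h1 := h.noise_subGaussian t ht
      rw [zero_pow two_ne_zero] at h1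
      exact h1.ae_eq_zero_of_hasSubgaussianMGF_zero
    have hmem : ∀ᵐ ω ∂P, ω ∈ good := by
      filter_upwards [hε] with ω hω
      have h0 : ∑ t ∈ Finset.range T, ε t ω • Tensor3.toEuclidean (X t ω) = 0 :=
        Finset.sum_eq_zero fun t ht => by rw [hω t (Finset.mem_range.1 ht), zero_smul]
      have h1 := hbound ω
      rw [h0, norm_zero, mul_zero] at h1
      exact (mul_nonpos_of_nonneg_of_nonpos hα h1).trans (by simp [regParam])
    have hone : P.real good = 1 := by
      have hae : good =ᵐ[P] Set.univ := Filter.eventuallyEq_univ.2 hmem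
      rw [measureReal_congr hae, probReal_univ]
    linarith
  have hR : 0 < R := pos_iff_ne_zero.2 hR0
  have hconc := measureReal_le_norm_sum_noise_smul_le (P := P) (ℱ := ℱ) (ε := ε)
    (V := fun t ω => Tensor3.toEuclidean (X t ω)) hR hT hL (zero_lt_one.trans_le hl)
    (fun t ht => Tensor3.continuous_toEuclidean.comp_stronglyMeasurable
      (h.measurable_context t ht).stronglyMeasurable)
    (fun t ht => by simpa only [Tensor3.norm_toEuclidean] using h.context_bound t ht)
    h.measurable_noise h.noise_condExp h.noise_subGaussian
  set bad := {ω | R + 8 * R * √(Real.log (4 * T * d / δ)) * √(2 * T * Real.log (4 * d / δ)) ≤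
    ‖∑ t ∈ Finset.range T, ε t ω • Tensor3.toEuclidean (X t ω)‖} with hbad
  have hcover : Set.univ ⊆ good ∪ bad := by
    intro ω _
    by_contra hcon
    rw [Set.mem_union, not_or] at hcon
    have hlt : ‖∑ t ∈ Finset.range T, ε t ω • Tensor3.toEuclidean (X t ω)‖ <
      R + 8 * R * √(Real.log (4 * T * d / δ)) * √(2 * T * Real.log (4 * d / δ)) :=
      not_le.1 hcon.2
    refine hcon.1 (le_trans ?_ (threshold_div_le_regParam hα R.2 hT hL hl))
    refine mul_le_mul_of_nonneg_left ((hbound ω).trans ?_) hα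
    exact mul_le_mul_of_nonneg_left hlt.le (by positivity)
  have h1 : 1 ≤ P.real good + P.real bad :=
    calc (1 : ℝ) = P.real Set.univ := by simp
      _ ≤ P.real (good ∪ bad) := measureReal_mono hcover
      _ ≤ _ := measureReal_union_le _ _
  have h2 := hconc.trans (failure_probability_le hδ hδ1 hT hd)
  linarith

end Noise

theorem lemma2 :
    (∀ (d₁ d₂ d₃ : ℕ), 0 < d₁ → 0 < d₂ → 0 < d₃ → ∀ A : Tensor3 d₁ d₂ d₃,
      Tensor3.dualNorm Tensor3.sliceNuclearNorm A = Tensor3.maxSliceOpNorm A) ∧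
    ∃ c : ℝ, 0 < c ∧
      ∀ (d₁ d₂ d₃ : ℕ), 0 < d₁ → 0 < d₂ → 0 < d₃ →
      ∀ (T₁ : ℕ), 0 < T₁ → ∀ (R : ℝ≥0) (cR : ℝ), 0 < cR → cR ≤ 1 →
      ∀ (δ : ℝ), 0 < δ → δ < 1 →
      ∀ (Ω : Type*) (mΩ : MeasurableSpace Ω) (P : Measure Ω), IsProbabilityMeasure P →
      ∀ (ℱ : Filtration ℕ mΩ) (X : ℕ → Ω → Tensor3 d₁ d₂ d₃) (ε : ℕ → Ω → ℝ),
        IsExploration P ℱ R T₁ X ε →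
        1 - δ ≤ P.real {ω |
          alphaConst cR * Tensor3.dualNorm Tensor3.sliceNuclearNorm (noiseAverage T₁ X ε ω) ≤
            regParam c (alphaConst cR) R T₁ (max d₁ (max d₂ d₃)) δ} := by
  refine ⟨fun d₁ d₂ d₃ _ _ _ A => Tensor3.dualNorm_sliceNuclearNorm A, 13, by norm_num, ?_⟩
  intro d₁ d₂ d₃ hd₁ _ _ T₁ hT R cR hcR _ δ hδ hδ1 Ω mΩ P hP ℱ X ε h
  have hα : 0 ≤ alphaConst cR := by unfold alphaConst; positivity
  have hd : 0 < max d₁ (max d₂ d₃) := lt_max_of_lt_left hd₁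
  have := h.one_sub_le_measureReal hT hd hα hδ hδ1
  exact_mod_cast this
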